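/- **Setting.** Let $V=\{1,\dots,p\}$ and let $F:2^V\to\mathbb R$ be submodular, i.e. $F(A)+F(B)\ge F(A\cup B)+F(A\cap B)$ for all $A,B\subset V$, with $F(\varnothing)=F(V)=0$ and $F(A)>0$ for every $A\ne\varnothing,V$. Let $f(w)=\int_{\mathbb R}F(\{k: w_k\ge\alpha\})\,d\alpha$, $w\in\mathbb R^p$, be its Lovász extension. A *lattice* is a family $\mathcal D\subset 2^V$ that contains $\varnothing$ and $V$ and is closed under union and intersection. Its *poset* $\Pi(\mathcal D)$ consists of the differences $T\setminus S$ of consecutive sets in maximal chains of $\mathcal D$; these blocks form a partition of $V$. It is ordered by: $A\succcurlyeq A'$ if every member of $\mathcal D$ that contains $A'$ also contains $A$. Let $\mathcal U^\circ_{\mathcal D}$ be the set of $w\in\mathbb R^p$ that are constant on every block and such that the value of $w$ on $A$ is strictly larger than its value on $A'$ whenever $A\succcurlyeq A'$ and $A\neq A'$. A set $A$ is *separable* for $G:2^V\to\mathbb R$ if $A$ is the disjoint union of two nonempty sets $B,C$ with $G(A)=G(B)+G(C)$, and *inseparable* otherwise. We say that $\mathcal D$ is *associated to* $w$ if $w\in\mathcal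 U^\circ_{\mathcal D}$ and 1. $F(A)+F(B)=F(A\cup B)+F(A\cap B)$ for all $A,B\in\mathcal D$; 2. every block $A$ is inseparable for $C\mapsto F(B\cup C)-F(B)$, where $B$ is the union of all blocks $A'\ne A$ with $A'\succcurlyeq A$; 3. $\mathcal D$ is maximal for inclusion among the lattices that satisfy 1 and 2 and have the same unordered partition into blocks. **Theorem (level set recovery).** Let $\lambda\ge 0$, $\sigma>0$, and $z=w^\ast+\sigma\varepsilon$, where $w^\ast\in\mathbb R^p$ and $\varepsilon\in\mathbb R^p$ is a standard Gaussian random vector. Let $\mathcal D$ be the lattice associated to $w^\ast$, let $A_1,\dots,A_m$ be the blocks of $\Pi(\mathcal D)$, numbered so that $A_i\succcurlyeq A_j$ implies $i\le j$, let $v^\ast_j$ be the value of $w^\ast$ on $A_j$, and let $B_j=A_1\cup\dots\cup A_j$ (so $B_0=\varnothing$). Assume that there are constants $\eta_1,\dots,\eta_m>0$ and $\nu>0$ such that - for all $j$ and all $C\subset A_j$, $$F(B_{j-1}\cup C)-F(B_{j-1})-\tfrac{|C|}{|A_j|}\big[F(B_{j-1}\cup A_j)-F(B_{j-1})\big]\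 \ge\ \eta_j\min\Big\{\tfrac{|C|}{|A_j|},\,1-\tfrac{|C|}{|A_j|}\Big\};$$ - for all $i\ne j$, if $A_i\succcurlyeq A_j$ then $v_i^\ast-v_j^\ast\ge\nu$; - for all $j$, $\ \lambda\,\Big|\frac{F(B_j)-F(B_{j-1})}{|A_j|}\Big|\le\nu/4$. Then for every $z\in\mathbb R^p$ the problem $\min_{w\in\mathbb R^p}\frac12\|w-z\|_2^2+\lambda f(w)$ has a unique minimizer; and for $z=w^\ast+\sigma\varepsilon$, the lattice $\mathcal D$ is associated to this minimizer $\hat w$ with probability at least $$1-\sum_{j=1}^m\exp\Big(-\frac{\nu^2|A_j|}{32\sigma^2}\Big)-2\sum_{j=1}^m|A_j|\exp\Big(-\frac{\lambda^2\eta_j^2}{2\sigma^2|A_j|^2}\Big).$$ -/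

import Mathlib

open MeasureTheory ProbabilityTheory

noncomputable section

namespace LevelSet

variable {p : ℕ}

/-- A submodular set-function on the subsets of `V = Fin p`, vanishing at `∅` and at `V`, and
positive at every other set. -/
structure IsPenalty (F : Finset (Fin p) → ℝ) : Prop where
  submodular : ∀ A B, F (A ∪ B) + F (A ∩ B) ≤ F A + F B
  empty : F ∅ = 0
  univ : F Finset.univ = 0
  pos : ∀ A, A ≠ ∅ → A ≠ Finset.univ → 0 < F A

/-- The level set `{w ≥ α}`. -/
def levelSet (w : EuclideanSpace ℝ (Fin p)) (α : ℝ) : Finset (Fin p) :=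
  Finset.univ.filter fun k => α ≤ w k

/-- The Lovász extension `f(w) = ∫ F({w ≥ α}) dα`. The integrand is bounded, and zero outside a
bounded interval when `F` vanishes at `∅` and at `V`. -/
def lovasz (F : Finset (Fin p) → ℝ) (w : EuclideanSpace ℝ (Fin p)) : ℝ :=
  ∫ α : ℝ, F (levelSet w α)

/-- The objective `½ ‖w - z‖² + λ f(w)` of the proximal problem. -/
def proxObjective (F : Finset (Fin p) → ℝ) (lam : ℝ) (z w : EuclideanSpace ℝ (Fin p)) : ℝ :=
  1 / 2 * ‖w - z‖ ^ 2 + lam * lovasz F w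

/-- `w` is a global minimizer of the proximal problem. -/
def IsProxSolution (F : Finset (Fin p) → ℝ) (lam : ℝ) (z w : EuclideanSpace ℝ (Fin p)) : Prop :=
  ∀ u, proxObjective F lam z w ≤ proxObjective F lam z u

/-- A (distributive) lattice of subsets of `V`: closed under union and intersection, and containing
`∅` and `V`. -/
structure IsSetLattice (D : Set (Finset (Fin p))) : Prop where
  empty_mem : ∅ ∈ D
  univ_mem : Finset.univ ∈ D
  union_mem : ∀ S ∈ D, ∀ T ∈ D, S ∪ T ∈ D
  inter_mem : ∀ S ∈ D, ∀ T ∈ D, S ∩ T ∈ D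

/-- The elements of the poset `Π(D)`: the differences of consecutive sets in maximal chains of `D`,
that is, the sets `T \ S` where `T` covers `S` in `D`. -/
def IsBlock (D : Set (Finset (Fin p))) (A : Finset (Fin p)) : Prop :=
  ∃ S ∈ D, ∃ T ∈ D, S ⊂ T ∧ (∀ U ∈ D, S ⊆ U → U ⊆ T → U = S ∨ U = T) ∧ A = T \ S

/-- The order `A ≽ A'` on `Π(D)`: every member of `D` that contains `A'` contains `A`. Members of
`D` play the role of level sets `{w ≥ α}`, so larger elements carry larger values. -/
def BlockGE (D : Set (Finset (Fin p))) (A A' : Finset (Fin p)) : Prop :=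
  ∀ S ∈ D, A' ⊆ S → A ⊆ S

/-- The union of all (strict) ancestors of `A` in `Π(D)`. -/
def ancestors (D : Set (Finset (Fin p))) (A : Finset (Fin p)) : Finset (Fin p) :=
  open Classical in
  Finset.univ.filter fun k => ∃ A', IsBlock D A' ∧ A' ≠ A ∧ BlockGE D A' A ∧ k ∈ A'

/-- The set `U°_D`: `w` is constant on each element of `Π(D)`, and strictly larger on strictly larger
elements. -/
def InOpenFace (D : Set (Finset (Fin p))) (w : EuclideanSpace ℝ (Fin p)) : Prop :=
  (∀ A, IsBlock D A → ∀ k ∈ A, ∀ l ∈ A, w k = w l) ∧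
  ∀ A A', IsBlock D A → IsBlock D A' → A ≠ A' → BlockGE D A A' →
    ∀ k ∈ A, ∀ l ∈ A', w l < w k

/-- `A` is separable for `G` if it splits into two nonempty parts on which `G` is additive. -/
def Separable (G : Finset (Fin p) → ℝ) (A : Finset (Fin p)) : Prop :=
  ∃ B C : Finset (Fin p), B ≠ ∅ ∧ C ≠ ∅ ∧ Disjoint B C ∧ B ∪ C = A ∧ G A = G B + G C

/-- Lattices on which `F` is modular and whose blocks are inseparable for the contraction of `F` by
the union of their ancestors. -/
structure IsPreAllowed (F : Finset (Fin p) → ℝ) (D : Set (Finset (Fin p))) : Prop where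
  lattice : IsSetLattice D
  modular : ∀ S ∈ D, ∀ T ∈ D, F S + F T = F (S ∪ T) + F (S ∩ T)
  inseparable : ∀ A, IsBlock D A →
    ¬ Separable (fun C => F (ancestors D A ∪ C) - F (ancestors D A)) A

/-- The lattices `D` for which `U°_D` is the relative interior of a face of `{w | f(w) ≤ 1}` up to
scaling: those of `IsPreAllowed` that are maximal among the ones with the same unordered partition
into blocks. -/
structure IsAllowed (F : Finset (Fin p) → ℝ) (D : Set (Finset (Fin p))) : Prop
    extends IsPreAllowed F D where
  maximal : ∀ D' : Set (Finset (Fin p)), IsPreAllowed F D' →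
    (∀ A, IsBlock D' A ↔ IsBlock D A) → D ⊆ D' → D' = D

/-- `D` is the lattice associated to `w`. -/
def IsAssociated (F : Finset (Fin p) → ℝ) (D : Set (Finset (Fin p)))
    (w : EuclideanSpace ℝ (Fin p)) : Prop :=
  IsAllowed F D ∧ InOpenFace D w

/-- `A 0, …, A (m - 1)` enumerates the elements of `Π(D)`, without repetition and in a topological
order (ancestors first). -/
structure IsTopologicalOrdering (D : Set (Finset (Fin p))) {m : ℕ}
    (A : Fin m → Finset (Fin p)) : Prop where
  injective : Function.Injective A
  isBlock_iff : ∀ S, IsBlock D S ↔ ∃ j, A j = S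
  topological : ∀ i j, BlockGE D (A i) (A j) → i ≤ j

/-- The union of the first `n` blocks. With blocks indexed from `0`, the block `A j` is preceded by
`prefixUnion A j`, and `prefixUnion A (j + 1)` includes it. -/
def prefixUnion {m : ℕ} (A : Fin m → Finset (Fin p)) (n : ℕ) : Finset (Fin p) :=
  (Finset.univ.filter fun i : Fin m => (i : ℕ) < n).biUnion A

end LevelSet

end

/-!
The Lovász extension is the support function of the base polytope of `F`, so the residual `z - ŵ` of
the proximal problem is the projection of `z` onto the base polytope of `λF`; this gives existence
and uniqueness, and certifies any `w` for which `z - w` is a base that is tight on the level sets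
of `w`.

For recovery, the candidate is constant on each block `A j`, with value the average of `z` over the
block minus the bias `λ (F (B j) - F (B (j - 1))) / |A j|`. Its residual on a block is the centred
noise plus the bias. The margin `η j` makes this residual a base as soon as the centred noise is at
most `λ η j / |A j|`, and modularity of `F` on the lattice makes it tight on every member. If the
averaged noise is below `ν / 4`, the values move by less than `ν / 2` and keep their order. The
probability that either smallness condition fails is bounded by Gaussian tails.
-/

namespace LevelSet

open scoped BigOperators RealInnerProductSpace

/-! ### Proximal points of support functions -/

section Proximal

variable {E : Type*} [NormedAddCommGroup E] [InnerProductSpace ℝ E]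

lemma half_norm_sub_sq_add_le_of_subgradient {h : E → ℝ} {z w : E}
    (hw : ∀ u, h w + ⟪z - w, u - w⟫ ≤ h u) (u : E) :
    1 / 2 * ‖w - z‖ ^ 2 + h w + 1 / 2 * ‖u - w‖ ^ 2 ≤ 1 / 2 * ‖u - z‖ ^ 2 + h u := by
  have hexpand := norm_sub_sq_real (u - w) (z - w)
  rw [sub_sub_sub_cancel_right, norm_sub_rev z w, real_inner_comm] at hexpand
  linarith [hw u]

theorem existsUnique_prox_of_isLUB {K : Set E} (hcomplete : IsComplete K) (hconvex : Convex ℝ K)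
    {h : E → ℝ} (hK : ∀ w, IsLUB ((⟪·, w⟫) '' K) (h w)) (z : E) :
    ∃! w, ∀ u, 1 / 2 * ‖w - z‖ ^ 2 + h w ≤ 1 / 2 * ‖u - z‖ ^ 2 + h u := by
  obtain ⟨s, hs, hproj⟩ :=
    exists_norm_eq_iInf_of_complete_convex (Set.image_nonempty.1 (hK z).nonempty) hcomplete
      hconvex z
  rw [norm_eq_iInf_iff_real_inner_le_zero hconvex hs] at hproj
  have hle (u : E) : ⟪s, u⟫ ≤ h u := (hK u).1 (Set.mem_image_of_mem _ hs)
  have heq : h (z - s) = ⟪s, z - s⟫ := by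
    refine le_antisymm ((isLUB_le_iff (hK _)).2 ?_) (hle _)
    rintro _ ⟨r, hr, rfl⟩
    have := hproj r hr
    rwa [inner_sub_right, sub_nonpos, real_inner_comm, real_inner_comm s] at this
  have hgrowth := half_norm_sub_sq_add_le_of_subgradient (h := h) (z := z) (w := z - s) fun u => by
    rw [heq, sub_sub_cancel, inner_sub_right s u, add_sub_cancel]
    exact hle u
  refine ⟨z - s, fun u => by linarith [hgrowth u, sq_nonneg ‖u - (z - s)‖], fun u hu => ?_⟩
  have hzero : ‖u - (z - s)‖ ^ 2 ≤ 0 := by linarith [hgrowth u, hu (z - s)]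
  exact sub_eq_zero.1 (norm_eq_zero.1 (pow_eq_zero_iff two_ne_zero |>.1
    (hzero.antisymm (sq_nonneg _))))

end Proximal

variable {p : ℕ}

/-! ### The Lovász extension and the base polytope -/

section Lovasz

variable {F : Finset (Fin p) → ℝ} {s w : EuclideanSpace ℝ (Fin p)}

/-- Submodular set-functions vanishing at `∅` and at `V`. Unlike `IsPenalty` this condition is
stable under multiplication by `λ ≥ 0`, so that `λ F` may take the place of `F`. -/
structure IsNormalizedSubmodular (F : Finset (Fin p) → ℝ) : Prop where
  submodular : ∀ S T, F (S ∪ T) + F (S ∩ T) ≤ F S + F T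
  empty : F ∅ = 0
  univ : F Finset.univ = 0

/-- The base polytope `B(F)`: the vectors whose sums are dominated by `F`, with equality on the
whole ground set. -/
def basePolytope (F : Finset (Fin p) → ℝ) : Set (EuclideanSpace ℝ (Fin p)) :=
  {s | (∀ C, ∑ k ∈ C, s k ≤ F C) ∧ ∑ k, s k = F Finset.univ}

lemma IsPenalty.isNormalizedSubmodular (hF : IsPenalty F) : IsNormalizedSubmodular F :=
  ⟨hF.submodular, hF.empty, hF.univ⟩

lemma IsNormalizedSubmodular.smul (hF : IsNormalizedSubmodular F) {c : ℝ} (hc : 0 ≤ c) :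
    IsNormalizedSubmodular (c • F) where
  submodular S T := by
    simpa only [Pi.smul_apply, smul_eq_mul, mul_add]
      using mul_le_mul_of_nonneg_left (hF.submodular S T) hc
  empty := by simp [hF.empty]
  univ := by simp [hF.univ]

lemma isClosed_basePolytope (F : Finset (Fin p) → ℝ) : IsClosed (basePolytope F) := by
  simp only [basePolytope, Set.ofPred_and, Set.ofPred_forall]
  exact (isClosed_iInter fun C => isClosed_le (by fun_prop) continuous_const).inter
    (isClosed_eq (by fun_prop) continuous_const)

lemma convex_basePolytope (F : Finset (Fin p) → ℝ) : Convex ℝ (basePolytope F) := by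
  intro s hs t ht a b ha hb hab
  have hsum (C : Finset (Fin p)) :
      ∑ k ∈ C, (a • s + b • t) k = a * ∑ k ∈ C, s k + b * ∑ k ∈ C, t k := by
    simp [Finset.sum_add_distrib, Finset.mul_sum]
  refine ⟨fun C => ?_, ?_⟩
  · calc ∑ k ∈ C, (a • s + b • t) k ≤ a * F C + b * F C := by
          rw [hsum]; gcongr <;> [exact hs.1 C; exact ht.1 C]
      _ = F C := by rw [← add_mul, hab, one_mul]
  · rw [hsum, hs.2, ht.2, ← add_mul, hab, one_mul]

lemma levelSet_eq_empty {α : ℝ} (h : ‖w‖ < α) : levelSet w α = ∅ :=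
  Finset.filter_eq_empty_iff.2 fun k _ =>
    not_le.2 ((le_abs_self _).trans_lt ((PiLp.norm_apply_le w k).trans_lt h))

lemma levelSet_eq_univ {α : ℝ} (h : α ≤ -‖w‖) : levelSet w α = Finset.univ :=
  Finset.filter_true_of_mem fun k _ =>
    h.trans ((neg_le_neg (PiLp.norm_apply_le w k)).trans (neg_abs_le _))

lemma measurable_comp_levelSet (F : Finset (Fin p) → ℝ) (w : EuclideanSpace ℝ (Fin p)) :
    Measurable fun α => F (levelSet w α) := by
  let _ : MeasurableSpace (Finset (Fin p)) := ⊤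
  refine measurable_from_top.comp (measurable_to_countable' fun S => ?_)
  have hfiber : levelSet w ⁻¹' {S} = {α | ∀ k, α ≤ w k ↔ k ∈ S} := by
    ext α
    simp [levelSet, Finset.ext_iff]
  rw [hfiber]
  exact measurableSet_setOfPred.2 <| .forall fun k =>
    (measurableSet_setOfPred.1 measurableSet_Iic).iff measurable_const

lemma integrable_comp_levelSet (h0 : F ∅ = 0) (h1 : F Finset.univ = 0)
    (w : EuclideanSpace ℝ (Fin p)) : Integrable fun α => F (levelSet w α) := by
  have hsupp : (Function.support fun α => F (levelSet w α)) ⊆ Set.Icc (-‖w‖) ‖w‖ := by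
    refine fun α hα => ⟨?_, ?_⟩ <;> by_contra! hlt <;> refine hα ?_
    · simpa only [levelSet_eq_univ hlt.le] using h1
    · simpa only [levelSet_eq_empty hlt] using h0
  refine (integrableOn_iff_integrable_of_support_subset hsupp).1 ?_
  exact Measure.integrableOn_of_bounded (M := ∑ S, ‖F S‖) measure_Icc_lt_top.ne
    (measurable_comp_levelSet F w).aestronglyMeasurable <| ae_of_all _ fun α =>
      Finset.single_le_sum (f := (‖F ·‖)) (fun _ _ => norm_nonneg _) (Finset.mem_univ _)

lemma lovasz_sum_eq_inner (hs : ∑ k, s k = 0) (w : EuclideanSpace ℝ (Fin p)) :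
    lovasz (fun C => ∑ k ∈ C, s k) w = ⟪s, w⟫ := by
  have hw (k : Fin p) : -‖w‖ ≤ w k :=
    (neg_le_neg (PiLp.norm_apply_le w k)).trans (neg_abs_le _)
  have hlayer (α : ℝ) : ∑ k ∈ levelSet w α, s k =
      ∑ k, (Set.Ioc (-‖w‖) (w k)).indicator (fun _ => s k) α := by
    rcases le_or_gt α (-‖w‖) with hα | hα
    · rw [levelSet_eq_univ hα, hs]
      exact (Finset.sum_eq_zero fun k _ =>
        Set.indicator_of_notMem (fun hmem => hmem.1.not_ge hα) _).symm
    · simp [levelSet, Finset.sum_filter, Set.indicator, hα]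
  have hint (k : Fin p) :
      ∫ α, (Set.Ioc (-‖w‖) (w k)).indicator (fun _ => s k) α = s k * w k + s k * ‖w‖ := by
    rw [integral_indicator_const _ measurableSet_Ioc, Real.volume_real_Ioc_of_le (hw k),
      smul_eq_mul]
    ring
  simp_rw [lovasz, hlayer]
  rw [integral_finsetSum _ fun k _ =>
    (integrable_indicator_iff measurableSet_Ioc).2 (integrableOn_const measure_Ioc_lt_top.ne)]
  simp_rw [hint, Finset.sum_add_distrib, ← Finset.sum_mul, hs, zero_mul, add_zero]
  simp [PiLp.inner_apply, mul_comm]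

lemma lovasz_smul (c : ℝ) (F : Finset (Fin p) → ℝ) (w : EuclideanSpace ℝ (Fin p)) :
    lovasz (c • F) w = c * lovasz F w :=
  integral_const_mul _ _

lemma inner_le_lovasz (h0 : F ∅ = 0) (h1 : F Finset.univ = 0) (hs : s ∈ basePolytope F)
    (w : EuclideanSpace ℝ (Fin p)) : ⟪s, w⟫ ≤ lovasz F w := by
  have hs0 : ∑ k, s k = 0 := hs.2.trans h1
  rw [← lovasz_sum_eq_inner hs0]
  exact integral_mono
    (integrable_comp_levelSet (F := fun C => ∑ k ∈ C, s k) Finset.sum_empty hs0 w)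
    (integrable_comp_levelSet h0 h1 w) fun α => hs.1 _

lemma inner_eq_lovasz (hs : ∑ k, s k = 0)
    (hw : ∀ α, ∑ k ∈ levelSet w α, s k = F (levelSet w α)) : ⟪s, w⟫ = lovasz F w := by
  rw [← lovasz_sum_eq_inner hs, lovasz, lovasz]
  simp_rw [hw]

end Lovasz

/-! ### Sums along ordered partitions -/

section Partition

variable {m : ℕ} {A : Fin m → Finset (Fin p)} {F : Finset (Fin p) → ℝ} {s : Fin p → ℝ}
  {S : Finset (Fin p)}

lemma mem_prefixUnion {n : ℕ} {k : Fin p} :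
    k ∈ prefixUnion A n ↔ ∃ i : Fin m, (i : ℕ) < n ∧ k ∈ A i := by
  simp [prefixUnion]

lemma prefixUnion_zero (A : Fin m → Finset (Fin p)) : prefixUnion A 0 = ∅ := by
  simp [prefixUnion]

lemma prefixUnion_succ (A : Fin m → Finset (Fin p)) (j : Fin m) :
    prefixUnion A (j + 1) = prefixUnion A j ∪ A j := by
  ext k
  simp only [Finset.mem_union, mem_prefixUnion, Nat.lt_succ_iff_lt_or_eq, or_and_right,
    exists_or, ← Fin.ext_iff, exists_eq_left]

lemma prefixUnion_last (hA : ∀ k, ∃! j, k ∈ A j) : prefixUnion A m = Finset.univ :=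
  Finset.eq_univ_of_forall fun k => mem_prefixUnion.2 ((hA k).exists.imp fun j hj => ⟨j.2, hj⟩)

lemma inter_prefixUnion_succ_inter (A : Fin m → Finset (Fin p)) (S : Finset (Fin p)) (j : Fin m) :
    S ∩ prefixUnion A (j + 1) ∩ prefixUnion A j = S ∩ prefixUnion A j := by
  rw [prefixUnion_succ, Finset.inter_assoc, Finset.union_inter_cancel_left]

lemma inter_prefixUnion_succ_union (A : Fin m → Finset (Fin p)) (S : Finset (Fin p)) (j : Fin m) :
    S ∩ prefixUnion A (j + 1) ∪ prefixUnion A j = prefixUnion A j ∪ S ∩ A j := by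
  rw [prefixUnion_succ, Finset.inter_union_distrib_left, Finset.union_right_comm,
    Finset.union_eq_right.2 Finset.inter_subset_right]

lemma sum_eq_sum_inter (hA : ∀ k, ∃! j, k ∈ A j) (s : Fin p → ℝ) (S : Finset (Fin p)) :
    ∑ k ∈ S, s k = ∑ j, ∑ k ∈ S ∩ A j, s k := by
  have hcover : Finset.univ.biUnion (fun j => S ∩ A j) = S := by
    rw [← Finset.inter_biUnion]
    exact Finset.inter_eq_left.2 fun k _ => by simpa using (hA k).exists
  rw [← Finset.sum_biUnion, hcover]
  intro i _ j _ hij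
  exact Finset.disjoint_left.2 fun k hi hj =>
    hij ((hA k).unique (Finset.mem_inter.1 hi).2 (Finset.mem_inter.1 hj).2)

lemma eq_sum_sub_inter_prefixUnion (hA : ∀ k, ∃! j, k ∈ A j) (h0 : F ∅ = 0)
    (S : Finset (Fin p)) :
    F S = ∑ j : Fin m, (F (S ∩ prefixUnion A (j + 1)) - F (S ∩ prefixUnion A j)) := by
  rw [Fin.sum_univ_eq_sum_range
      (fun n => F (S ∩ prefixUnion A (n + 1)) - F (S ∩ prefixUnion A n)) m,
    Finset.sum_range_sub (fun n => F (S ∩ prefixUnion A n)), prefixUnion_zero,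
    prefixUnion_last hA, Finset.inter_empty, Finset.inter_univ, h0, sub_zero]

lemma sum_le_of_forall_sum_le_sub (hA : ∀ k, ∃! j, k ∈ A j) (h0 : F ∅ = 0)
    (hF : ∀ S T, F (S ∪ T) + F (S ∩ T) ≤ F S + F T)
    (hs : ∀ j, ∀ C ⊆ A j, ∑ k ∈ C, s k ≤ F (prefixUnion A j ∪ C) - F (prefixUnion A j))
    (S : Finset (Fin p)) : ∑ k ∈ S, s k ≤ F S := by
  rw [sum_eq_sum_inter hA, eq_sum_sub_inter_prefixUnion hA h0 S]
  refine Finset.sum_le_sum fun j _ => (hs j _ Finset.inter_subset_right).trans ?_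
  have hsub := hF (S ∩ prefixUnion A (j + 1)) (prefixUnion A j)
  rw [inter_prefixUnion_succ_union, inter_prefixUnion_succ_inter] at hsub
  linarith

lemma sum_eq_of_forall_disjoint_or_sum_eq_sub (hA : ∀ k, ∃! j, k ∈ A j) (h0 : F ∅ = 0)
    (hs : ∀ j, Disjoint S (A j) ∨
      ∑ k ∈ S ∩ A j, s k = F (S ∩ prefixUnion A (j + 1)) - F (S ∩ prefixUnion A j)) :
    ∑ k ∈ S, s k = F S := by
  rw [sum_eq_sum_inter hA, eq_sum_sub_inter_prefixUnion hA h0 S]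
  refine Finset.sum_congr rfl fun j _ => (hs j).elim (fun hdisj => ?_) id
  rw [prefixUnion_succ, Finset.inter_union_distrib_left, Finset.disjoint_iff_inter_eq_empty.1 hdisj]
  simp

end Partition

/-! ### The greedy algorithm and the proximal problem -/

section Greedy

variable {F : Finset (Fin p) → ℝ} {e : Equiv.Perm (Fin p)}

/-- Edmonds' greedy vector: the increments of `F` when the elements of `V` are added one by one
in the order `e 0, e 1, …`. -/
def greedyBase (F : Finset (Fin p) → ℝ) (e : Equiv.Perm (Fin p)) : EuclideanSpace ℝ (Fin p) :=
  WithLp.toLp 2 fun k => F (prefixUnion (fun i => {e i}) (e.symm k + 1)) -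
    F (prefixUnion (fun i => {e i}) (e.symm k))

lemma greedyBase_apply (F : Finset (Fin p) → ℝ) (e : Equiv.Perm (Fin p)) (j : Fin p) :
    greedyBase F e (e j) =
      F (prefixUnion (fun i => {e i}) (j + 1)) - F (prefixUnion (fun i => {e i}) j) := by
  simp [greedyBase]

lemma existsUnique_mem_singleton_perm (e : Equiv.Perm (Fin p)) (k : Fin p) :
    ∃! j, k ∈ ({e j} : Finset (Fin p)) := by
  simpa only [Finset.mem_singleton, eq_comm] using e.bijective.existsUnique k

lemma greedyBase_mem_basePolytope (hF : IsNormalizedSubmodular F) (e : Equiv.Perm (Fin p)) :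
    greedyBase F e ∈ basePolytope F := by
  have hpart := existsUnique_mem_singleton_perm e
  refine ⟨sum_le_of_forall_sum_le_sub hpart hF.empty hF.submodular fun j C hC => ?_,
    sum_eq_of_forall_disjoint_or_sum_eq_sub hpart hF.empty fun j => .inr ?_⟩
  · rcases Finset.subset_singleton_iff.1 hC with rfl | rfl
    · simp
    · rw [Finset.sum_singleton, greedyBase_apply, prefixUnion_succ]
  · simp only [Finset.univ_inter, Finset.sum_singleton, greedyBase_apply]

lemma sum_greedyBase_levelSet (h0 : F ∅ = 0) {w : EuclideanSpace ℝ (Fin p)}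
    (he : Antitone (w ∘ e)) (α : ℝ) :
    ∑ k ∈ levelSet w α, greedyBase F e k = F (levelSet w α) := by
  refine sum_eq_of_forall_disjoint_or_sum_eq_sub (existsUnique_mem_singleton_perm e) h0
    fun j => ?_
  by_cases hj : e j ∈ levelSet w α
  · have hprefix {n : ℕ} (hn : n ≤ j + 1) : prefixUnion (fun i => {e i}) n ⊆ levelSet w α := by
      intro k hk
      obtain ⟨i, hin, hki⟩ := mem_prefixUnion.1 hk
      obtain rfl := Finset.mem_singleton.1 hki
      have hij : i ≤ j := Nat.lt_succ_iff.1 (hin.trans_le hn)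
      exact Finset.mem_filter.2 ⟨Finset.mem_univ _, (Finset.mem_filter.1 hj).2.trans (he hij)⟩
    right
    rw [Finset.inter_eq_right.2 (hprefix le_rfl), Finset.inter_eq_right.2 (hprefix (by lia)),
      Finset.inter_singleton_of_mem hj, Finset.sum_singleton, greedyBase_apply]
  · exact .inl (Finset.disjoint_singleton_right.2 hj)

theorem isGreatest_inner_basePolytope (hF : IsNormalizedSubmodular F)
    (w : EuclideanSpace ℝ (Fin p)) : IsGreatest ((⟪·, w⟫) '' basePolytope F) (lovasz F w) := by
  have he : Antitone (w ∘ Tuple.sort fun k => -w k) := fun i j hij =>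
    neg_le_neg_iff.1 (Tuple.monotone_sort (fun k => -w k) hij)
  have hmem := greedyBase_mem_basePolytope hF (Tuple.sort fun k => -w k)
  refine ⟨⟨_, hmem, inner_eq_lovasz (hmem.2.trans hF.univ) (sum_greedyBase_levelSet hF.empty he)⟩,
    ?_⟩
  rintro _ ⟨s, hs, rfl⟩
  exact inner_le_lovasz hF.empty hF.univ hs w

theorem existsUnique_isProxSolution (hF : IsNormalizedSubmodular F) {lam : ℝ} (hlam : 0 ≤ lam)
    (z : EuclideanSpace ℝ (Fin p)) : ∃! w, IsProxSolution F lam z w := by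
  have h := existsUnique_prox_of_isLUB (isClosed_basePolytope (lam • F)).isComplete
    (convex_basePolytope _) (fun w => (isGreatest_inner_basePolytope (hF.smul hlam) w).isLUB) z
  simpa only [lovasz_smul, IsProxSolution, proxObjective] using h

theorem isProxSolution_of_sub_mem_basePolytope (hF : IsNormalizedSubmodular F) {lam : ℝ}
    {z w : EuclideanSpace ℝ (Fin p)} (hmem : z - w ∈ basePolytope (lam • F))
    (htight : ∀ α, ∑ k ∈ levelSet w α, (z - w) k = (lam • F) (levelSet w α)) :
    IsProxSolution F lam z w := by
  have h0 : (lam • F) ∅ = 0 := by simp [hF.empty]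
  have h1 : (lam • F) Finset.univ = 0 := by simp [hF.univ]
  have hsub (u : EuclideanSpace ℝ (Fin p)) :
      lovasz (lam • F) w + ⟪z - w, u - w⟫ ≤ lovasz (lam • F) u := by
    rw [← inner_eq_lovasz (hmem.2.trans h1) htight, inner_sub_right, add_sub_cancel]
    exact inner_le_lovasz h0 h1 hmem u
  intro u
  have hgrowth := half_norm_sub_sq_add_le_of_subgradient hsub u
  rw [lovasz_smul, lovasz_smul] at hgrowth
  unfold proxObjective
  linarith [sq_nonneg ‖u - w‖]

end Greedy

/-! ### Blocks of a lattice of sets -/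

section Lattice

variable {m : ℕ} {D : Set (Finset (Fin p))} {A : Fin m → Finset (Fin p)} {B B' S U : Finset (Fin p)}
  {x : Fin p}

lemma IsSetLattice.exists_isLeast_mem (hD : IsSetLattice D) (x : Fin p) :
    ∃ T, IsLeast {U ∈ D | x ∈ U} T := by
  classical
  refine ⟨({U | U ∈ D ∧ x ∈ U} : Finset (Finset (Fin p))).inf id,
    Finset.inf_mem {U ∈ D | x ∈ U} ⟨hD.univ_mem, Finset.mem_univ x⟩ ?_ _ _
      fun U hU => by simpa using hU, fun U hU => Finset.inf_le (f := id) (by simpa using hU)⟩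
  exact fun S hS T hT => ⟨hD.inter_mem S hS.1 T hT.1, Finset.mem_inter.2 ⟨hS.2, hT.2⟩⟩

lemma IsSetLattice.exists_isGreatest_notMem (hD : IsSetLattice D) (x : Fin p) :
    ∃ S, IsGreatest {U ∈ D | x ∉ U} S := by
  classical
  refine ⟨({U | U ∈ D ∧ x ∉ U} : Finset (Finset (Fin p))).sup id,
    Finset.sup_mem {U ∈ D | x ∉ U} ⟨hD.empty_mem, Finset.notMem_empty x⟩ ?_ _ _
      fun U hU => by simpa using hU, fun U hU => Finset.le_sup (f := id) (by simpa using hU)⟩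
  exact fun S hS T hT => ⟨hD.union_mem S hS.1 T hT.1, by simp [hS.2, hT.2]⟩

lemma IsSetLattice.exists_isBlock_mem (hD : IsSetLattice D) (x : Fin p) :
    ∃ B, IsBlock D B ∧ x ∈ B := by
  obtain ⟨T, ⟨hT, hxT⟩, hleast⟩ := hD.exists_isLeast_mem x
  obtain ⟨S, ⟨hS, hxS⟩, hgreatest⟩ := hD.exists_isGreatest_notMem x
  have hxST : x ∉ S ∩ T := fun h => hxS (Finset.mem_inter.1 h).1
  refine ⟨T \ (S ∩ T), ⟨S ∩ T, hD.inter_mem S hS T hT, T, hT,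
    ⟨Finset.inter_subset_right, fun h => hxST (h hxT)⟩, fun U hU hSU hUT => ?_, rfl⟩,
    Finset.mem_sdiff.2 ⟨hxT, hxST⟩⟩
  by_cases hxU : x ∈ U
  · exact .inr (hUT.antisymm (hleast ⟨hU, hxU⟩))
  · exact .inl ((Finset.subset_inter (hgreatest ⟨hU, hxU⟩) hUT).antisymm hSU)

lemma IsBlock.nonempty (hB : IsBlock D B) : B.Nonempty := by
  obtain ⟨S, -, T, -, hST, -, rfl⟩ := hB
  exact Finset.sdiff_nonempty.2 hST.2

lemma IsBlock.subset_of_mem (hB : IsBlock D B) (hD : IsSetLattice D) (hU : U ∈ D) (hxB : x ∈ B)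
    (hxU : x ∈ U) : B ⊆ U := by
  obtain ⟨S, hS, T, hT, hST, hcov, rfl⟩ := hB
  obtain ⟨hxT, hxS⟩ := Finset.mem_sdiff.1 hxB
  rcases hcov (S ∪ U ∩ T) (hD.union_mem S hS _ (hD.inter_mem U hU T hT)) Finset.subset_union_left
    (Finset.union_subset hST.1 Finset.inter_subset_right) with h | h
  · exact absurd (h ▸ Finset.mem_union_right S (Finset.mem_inter.2 ⟨hxU, hxT⟩)) hxS
  · exact sdiff_le_iff.2 (h.ge.trans (sup_le_sup_left inf_le_left S))

lemma IsBlock.subset_of_mem_isBlock (hB : IsBlock D B) (hD : IsSetLattice D) (hB' : IsBlock D B')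
    (hx : x ∈ B) (hx' : x ∈ B') : B ⊆ B' := by
  obtain ⟨S, hS, T, hT, -, -, rfl⟩ := hB'
  obtain ⟨hxT, hxS⟩ := Finset.mem_sdiff.1 hx'
  exact fun y hy => Finset.mem_sdiff.2
    ⟨hB.subset_of_mem hD hT hx hxT hy, fun hyS => hxS (hB.subset_of_mem hD hS hy hyS hx)⟩

lemma IsBlock.eq_of_mem (hB : IsBlock D B) (hD : IsSetLattice D) (hB' : IsBlock D B')
    (hx : x ∈ B) (hx' : x ∈ B') : B = B' :=
  (hB.subset_of_mem_isBlock hD hB' hx hx').antisymm (hB'.subset_of_mem_isBlock hD hB hx' hx)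

lemma IsTopologicalOrdering.isBlock (hA : IsTopologicalOrdering D A) (j : Fin m) :
    IsBlock D (A j) :=
  (hA.isBlock_iff _).2 ⟨j, rfl⟩

lemma IsTopologicalOrdering.existsUnique_mem (hA : IsTopologicalOrdering D A)
    (hD : IsSetLattice D) (k : Fin p) : ∃! j, k ∈ A j := by
  obtain ⟨B, hB, hk⟩ := hD.exists_isBlock_mem k
  obtain ⟨j, rfl⟩ := (hA.isBlock_iff B).1 hB
  exact ⟨j, hk, fun i hi => hA.injective ((hA.isBlock i).eq_of_mem hD hB hi hk)⟩

lemma IsSetLattice.mem_of_forall_blockGE (hD : IsSetLattice D)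
    (hS : ∀ B B', IsBlock D B → IsBlock D B' → BlockGE D B B' →
      ∀ k ∈ B, ∀ l ∈ B', l ∈ S → k ∈ S) : S ∈ D := by
  choose T hT hleast using hD.exists_isLeast_mem
  have hTS {x : Fin p} (hx : x ∈ S) : T x ⊆ S := by
    intro y hy
    obtain ⟨B', hB', hxB'⟩ := hD.exists_isBlock_mem x
    obtain ⟨B, hB, hyB⟩ := hD.exists_isBlock_mem y
    refine hS B B' hB hB' (fun U hU hBU => ?_) y hyB x hxB' hx
    exact hB.subset_of_mem hD hU hyB (hleast x ⟨hU, hBU hxB'⟩ hy)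
  have hsup : S.sup T = S := by
    refine (Finset.sup_le fun x hx => hTS hx).antisymm fun x hx => ?_
    exact Finset.le_sup (f := T) hx (hT x).2
  exact hsup ▸ Finset.sup_mem D hD.empty_mem hD.union_mem S T fun x _ => (hT x).1

lemma IsTopologicalOrdering.prefixUnion_mem (hA : IsTopologicalOrdering D A)
    (hD : IsSetLattice D) (n : ℕ) : prefixUnion A n ∈ D := by
  refine hD.mem_of_forall_blockGE fun B B' hB hB' hge k hk l hl hmem => ?_
  obtain ⟨i, rfl⟩ := (hA.isBlock_iff B).1 hB
  obtain ⟨j, rfl⟩ := (hA.isBlock_iff B').1 hB'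
  obtain ⟨j', hj', hl'⟩ := mem_prefixUnion.1 hmem
  obtain rfl := (hA.existsUnique_mem hD l).unique hl hl'
  exact mem_prefixUnion.2 ⟨i, (Fin.le_def.1 (hA.topological i j hge)).trans_lt hj', hk⟩

lemma InOpenFace.levelSet_mem {w : EuclideanSpace ℝ (Fin p)} (hw : InOpenFace D w)
    (hD : IsSetLattice D) (α : ℝ) : levelSet w α ∈ D := by
  refine hD.mem_of_forall_blockGE fun B B' hB hB' hge k hk l hl hmem => ?_
  have hlk : w l ≤ w k := by
    rcases eq_or_ne B B' with rfl | hne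
    · exact (hw.1 B hB l hl k hk).le
    · exact (hw.2 B B' hB hB' hne hge k hk l hl).le
  exact Finset.mem_filter.2 ⟨Finset.mem_univ k, (Finset.mem_filter.1 hmem).2.trans hlk⟩

lemma IsTopologicalOrdering.sum_eq_of_modular (hA : IsTopologicalOrdering D A)
    (hD : IsSetLattice D) {F : Finset (Fin p) → ℝ} (h0 : F ∅ = 0)
    (hF : ∀ S ∈ D, ∀ T ∈ D, F S + F T = F (S ∪ T) + F (S ∩ T)) {s : Fin p → ℝ}
    (hs : ∀ j : Fin m, ∑ k ∈ A j, s k = F (prefixUnion A (j + 1)) - F (prefixUnion A j))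
    (hS : S ∈ D) : ∑ k ∈ S, s k = F S := by
  refine sum_eq_of_forall_disjoint_or_sum_eq_sub (hA.existsUnique_mem hD) h0 fun j => ?_
  refine or_iff_not_imp_left.2 fun hmeet => ?_
  obtain ⟨x, hxS, hxA⟩ := Finset.not_disjoint_iff.1 hmeet
  have hsub : S ∩ A j = A j :=
    Finset.inter_eq_right.2 ((hA.isBlock j).subset_of_mem hD hS hxA hxS)
  have hmod := hF _ (hD.inter_mem S hS _ (hA.prefixUnion_mem hD (j + 1))) _
    (hA.prefixUnion_mem hD j)
  rw [inter_prefixUnion_succ_union, inter_prefixUnion_succ_inter, hsub,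
    ← prefixUnion_succ] at hmod
  rw [hsub, hs]
  linarith

end Lattice

/-! ### Gaussian tails -/

section GaussianTails

-- Shifting by `t` multiplies the density at `x ≥ 0` by at most `exp (-t² / 2v)`.
lemma gaussianReal_Ici_le {v : NNReal} (hv : v ≠ 0) {t : ℝ} (ht : 0 ≤ t) :
    gaussianReal 0 v (Set.Ici t) ≤
      ENNReal.ofReal (Real.exp (-(t ^ 2 / (2 * v)))) * gaussianReal 0 v (Set.Ici 0) := by
  have hshift : gaussianReal 0 v (Set.Ici t) = gaussianReal (-t) v (Set.Ici 0) := by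
    have hmap := gaussianReal_map_add_const (μ := 0) (v := v) (-t)
    rw [zero_add] at hmap
    rw [← hmap, Measure.map_apply (by fun_prop) measurableSet_Ici]
    simp
  rw [hshift, gaussianReal_apply _ hv, gaussianReal_apply _ hv,
    ← lintegral_const_mul _ (by fun_prop)]
  refine setLIntegral_mono (by fun_prop) fun x hx => ?_
  have hx : 0 ≤ t * x := mul_nonneg ht hx
  rw [gaussianPDF, gaussianPDF, ← ENNReal.ofReal_mul (Real.exp_nonneg _)]
  refine ENNReal.ofReal_le_ofReal ?_
  rw [gaussianPDFReal, gaussianPDFReal, mul_left_comm, ← Real.exp_add, ← neg_div, ← add_div]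
  gcongr
  linarith

lemma gaussianReal_Iic_neg (v : NNReal) (t : ℝ) :
    gaussianReal 0 v (Set.Iic (-t)) = gaussianReal 0 v (Set.Ici t) := by
  have hmap := gaussianReal_map_neg (μ := 0) (v := v)
  rw [neg_zero] at hmap
  conv_rhs => rw [← hmap, Measure.map_apply (by fun_prop) measurableSet_Ici]
  simp [Set.neg_Ici]

lemma gaussianReal_Ici_zero {v : NNReal} (hv : v ≠ 0) :
    gaussianReal 0 v (Set.Ici 0) + gaussianReal 0 v (Set.Ici 0) = 1 := by
  have := nullSingletonClass_gaussianReal (μ := 0) hv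
  have hflip := gaussianReal_Iic_neg v 0
  rw [neg_zero, ← measure_congr Iio_ae_eq_Iic] at hflip
  nth_rw 2 [← hflip]
  rw [← Set.compl_Ici, prob_add_prob_compl measurableSet_Ici]

theorem gaussianReal_real_le_abs_le {v : NNReal} (hv : v ≠ 0) {t : ℝ} (ht : 0 ≤ t) :
    (gaussianReal 0 v).real {x | t ≤ |x|} ≤ Real.exp (-(t ^ 2 / (2 * v))) := by
  refine ENNReal.toReal_le_of_le_ofReal (Real.exp_nonneg _) ?_
  have hsplit : {x : ℝ | t ≤ |x|} = Set.Ici t ∪ Set.Iic (-t) := by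
    ext x
    exact le_abs.trans (or_congr_right (le_neg (a := t)))
  calc gaussianReal 0 v {x | t ≤ |x|}
      ≤ gaussianReal 0 v (Set.Ici t) + gaussianReal 0 v (Set.Ici t) := by
        rw [hsplit]
        exact (measure_union_le _ _).trans_eq (by rw [gaussianReal_Iic_neg])
    _ ≤ ENNReal.ofReal (Real.exp (-(t ^ 2 / (2 * v)))) *
          (gaussianReal 0 v (Set.Ici 0) + gaussianReal 0 v (Set.Ici 0)) := by
        rw [mul_add]
        gcongr <;> exact gaussianReal_Ici_le hv ht
    _ = ENNReal.ofReal (Real.exp (-(t ^ 2 / (2 * v)))) := by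
        rw [gaussianReal_Ici_zero hv, mul_one]

variable {E : Type*} [NormedAddCommGroup E] [InnerProductSpace ℝ E] [FiniteDimensional ℝ E]
  [MeasurableSpace E] [BorelSpace E]

lemma map_inner_stdGaussian (a : E) :
    (stdGaussian E).map (⟪a, ·⟫) = (gaussianReal 0 1).map (‖a‖ * ·) := by
  have hdual := IsGaussian.map_eq_gaussianReal (μ := stdGaussian E)
    (InnerProductSpace.toDual ℝ E a)
  rw [integral_strongDual_stdGaussian, variance_dual_stdGaussian,
    LinearIsometryEquiv.norm_map] at hdual
  rw [gaussianReal_map_const_mul, mul_zero, mul_one]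
  convert! hdual
  exact (Real.toNNReal_of_nonneg (sq_nonneg _)).symm

theorem measureReal_le_abs_inner_le {Ω : Type*} [MeasurableSpace Ω] {P : Measure Ω} {ε : Ω → E}
    (hε : HasLaw ε (stdGaussian E) P) {a : E} {r : ℝ} (hr : 0 < r) (ha : ‖a‖ ≤ r) {t : ℝ}
    (ht : 0 ≤ t) : P.real {ω | t ≤ |⟪a, ε ω⟫|} ≤ Real.exp (-((t / r) ^ 2 / 2)) := by
  have hmeas : MeasurableSet {x : ℝ | t ≤ |x|} := measurableSet_le measurable_const (by fun_prop)
  have hlaw : P.real {ω | t ≤ |⟪a, ε ω⟫|} = (gaussianReal 0 1).real {x | t ≤ |‖a‖ * x|} := by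
    have hinner : Measurable fun x : E => ⟪a, x⟫ := by fun_prop
    have hmul : Measurable fun x : ℝ => ‖a‖ * x := by fun_prop
    rw [hε.measureReal_eq (p := fun x => t ≤ |⟪a, x⟫|) (hinner hmeas)]
    exact (map_measureReal_apply hinner hmeas).symm.trans
      (map_inner_stdGaussian a ▸ map_measureReal_apply hmul hmeas)
  have hsub : {x : ℝ | t ≤ |‖a‖ * x|} ⊆ {x | t / r ≤ |x|} := by
    intro x hx
    rw [Set.mem_ofPred_eq, div_le_iff₀' hr]
    calc t ≤ |‖a‖ * x| := hx
      _ ≤ r * |x| := by rw [abs_mul, abs_norm]; gcongr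
  calc P.real {ω | t ≤ |⟪a, ε ω⟫|} ≤ (gaussianReal 0 1).real {x | t / r ≤ |x|} :=
        hlaw.trans_le (measureReal_mono hsub)
    _ ≤ Real.exp (-((t / r) ^ 2 / 2)) := by
        simpa using gaussianReal_real_le_abs_le one_ne_zero (div_nonneg ht hr.le)

end GaussianTails

/-! ### Block averages of a Gaussian vector -/

section BlockAverages

variable {ι : Type*} [Fintype ι] {S : Finset ι}

/-- The vector `1_S / |S|`, which represents the averaging functional `x ↦ 𝔼 k ∈ S, x k`. -/
noncomputable def averagingVector (S : Finset ι) : EuclideanSpace ℝ ι :=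
  WithLp.toLp 2 ((S : Set ι).indicator fun _ => (S.card : ℝ)⁻¹)

lemma inner_averagingVector (S : Finset ι) (x : EuclideanSpace ℝ ι) :
    ⟪averagingVector S, x⟫ = 𝔼 k ∈ S, x k := by
  classical
  simp [averagingVector, PiLp.inner_apply, Finset.expect_eq_sum_div_card, Set.indicator_apply,
    div_eq_mul_inv, Finset.sum_mul]

lemma norm_averagingVector_sq (hS : S.Nonempty) :
    ‖averagingVector S‖ ^ 2 = (S.card : ℝ)⁻¹ := by
  rw [← real_inner_self_eq_norm_sq, inner_averagingVector]
  exact (Finset.expect_congr rfl fun _ hk => Set.indicator_of_mem hk _).trans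
    (Finset.expect_const hS _)

lemma norm_single_sub_averagingVector_le [DecidableEq ι] {k : ι} (hk : k ∈ S) :
    ‖EuclideanSpace.single k (1 : ℝ) - averagingVector S‖ ≤ 1 := by
  have hinner : ⟪EuclideanSpace.single k (1 : ℝ), averagingVector S⟫ = (S.card : ℝ)⁻¹ := by
    simp [EuclideanSpace.inner_single_left, averagingVector, hk]
  have hinv : 0 ≤ (S.card : ℝ)⁻¹ := by positivity
  rw [← sq_le_one_iff₀ (norm_nonneg _), norm_sub_sq_real, hinner, norm_averagingVector_sq ⟨k, hk⟩,
    PiLp.norm_single, norm_one]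
  linarith

variable {Ω : Type*} [MeasurableSpace Ω] {P : Measure Ω} {ε : Ω → EuclideanSpace ℝ ι} {t : ℝ}

lemma measureReal_le_abs_expect_le (hε : HasLaw ε (stdGaussian (EuclideanSpace ℝ ι)) P)
    (hS : S.Nonempty) (ht : 0 ≤ t) :
    P.real {ω | t ≤ |𝔼 k ∈ S, ε ω k|} ≤ Real.exp (-(t ^ 2 * S.card / 2)) := by
  have hnorm : 0 < ‖averagingVector S‖ ^ 2 := by
    rw [norm_averagingVector_sq hS]
    exact inv_pos.2 (Nat.cast_pos.2 hS.card_pos)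
  have htail := measureReal_le_abs_inner_le hε
    ((norm_nonneg _).lt_of_ne' (pow_ne_zero_iff two_ne_zero |>.1 hnorm.ne')) le_rfl ht
  simpa only [inner_averagingVector, div_pow, norm_averagingVector_sq hS, div_inv_eq_mul]
    using htail

lemma measureReal_le_abs_sub_expect_le (hε : HasLaw ε (stdGaussian (EuclideanSpace ℝ ι)) P)
    {k : ι} (hk : k ∈ S) (ht : 0 ≤ t) :
    P.real {ω | t ≤ |ε ω k - 𝔼 l ∈ S, ε ω l|} ≤ Real.exp (-(t ^ 2 / 2)) := by
  classical
  simpa [inner_sub_left, inner_averagingVector, EuclideanSpace.inner_single_left]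
    using measureReal_le_abs_inner_le hε one_pos (norm_single_sub_averagingVector_le hk) ht

theorem one_sub_sum_exp_sub_sum_exp_le_measureReal [IsProbabilityMeasure P]
    (hε : HasLaw ε (stdGaussian (EuclideanSpace ℝ ι)) P) {J : Type*} [Fintype J]
    {A : J → Finset ι} (hA : ∀ j, (A j).Nonempty) {t r : J → ℝ}
    (ht : ∀ j, 0 ≤ t j) (hr : ∀ j, 0 ≤ r j) :
    1 - ∑ j, Real.exp (-(t j ^ 2 * (A j).card / 2))
      - ∑ j, ((A j).card : ℝ) * Real.exp (-(r j ^ 2 / 2)) ≤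
      P.real {ω | (∀ j, |𝔼 k ∈ A j, ε ω k| < t j) ∧
        ∀ j, ∀ k ∈ A j, |ε ω k - 𝔼 l ∈ A j, ε ω l| < r j} := by
  set G := {ω | (∀ j, |𝔼 k ∈ A j, ε ω k| < t j) ∧
    ∀ j, ∀ k ∈ A j, |ε ω k - 𝔼 l ∈ A j, ε ω l| < r j}
  let M (j : J) : Set Ω := {ω | t j ≤ |𝔼 k ∈ A j, ε ω k|}
  let N (j : J) (k : ι) : Set Ω := {ω | r j ≤ |ε ω k - 𝔼 l ∈ A j, ε ω l|}
  have hM : P.real (⋃ j, M j) ≤ ∑ j, Real.exp (-(t j ^ 2 * (A j).card / 2)) :=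
    (measureReal_iUnion_fintype_le _).trans <| Finset.sum_le_sum fun j _ =>
      measureReal_le_abs_expect_le hε (hA j) (ht j)
  have hN : P.real (⋃ j, ⋃ k ∈ A j, N j k) ≤
      ∑ j, ((A j).card : ℝ) * Real.exp (-(r j ^ 2 / 2)) := by
    refine (measureReal_iUnion_fintype_le _).trans <| Finset.sum_le_sum fun j _ => ?_
    rw [← nsmul_eq_mul]
    exact (measureReal_biUnion_finset_le _ _).trans <| Finset.sum_le_card_nsmul _ _ _ fun k hk =>
      measureReal_le_abs_sub_expect_le hε hk (hr j)
  have hcover : Set.univ ⊆ G ∪ ((⋃ j, M j) ∪ ⋃ j, ⋃ k ∈ A j, N j k) := by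
    intro ω _
    by_contra hω
    simp only [Set.mem_union, Set.mem_iUnion, not_or, not_exists] at hω
    exact hω.1 ⟨fun j => not_le.1 (hω.2.1 j), fun j k hk => not_le.1 (hω.2.2 j k hk)⟩
  have htotal : 1 ≤ P.real G + (P.real (⋃ j, M j) + P.real (⋃ j, ⋃ k ∈ A j, N j k)) := by
    rw [← probReal_univ (μ := P)]
    exact (measureReal_mono hcover).trans <| (measureReal_union_le _ _).trans <|
      add_le_add_right (measureReal_union_le _ _) _
  linarith

end BlockAverages

/-! ### Deterministic recovery -/

section Margin

variable {ι : Type*} {A C : Finset ι} {x : ι → ℝ} {c : ℝ}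

lemma sum_sub_expect (A : Finset ι) (x : ι → ℝ) : ∑ k ∈ A, (x k - 𝔼 l ∈ A, x l) = 0 := by
  rw [Finset.sum_sub_distrib, Finset.sum_const, nsmul_eq_mul, Finset.card_mul_expect, sub_self]

-- Bound the sum over `C` directly, or as minus the sum over `A \ C`.
lemma sum_le_mul_min_of_abs_le (hA : A.Nonempty) (hsum : ∑ k ∈ A, x k = 0)
    (hx : ∀ k ∈ A, |x k| ≤ c / A.card) (hC : C ⊆ A) :
    ∑ k ∈ C, x k ≤ c * min ((C.card : ℝ) / A.card) (1 - (C.card : ℝ) / A.card) := by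
  have habs {S : Finset ι} (hS : S ⊆ A) : |∑ k ∈ S, x k| ≤ S.card * (c / A.card) := by
    rw [← nsmul_eq_mul]
    exact (Finset.abs_sum_le_sum_abs _ _).trans
      (Finset.sum_le_card_nsmul _ _ _ fun k hk => hx k (hS hk))
  have hdirect : ∑ k ∈ C, x k ≤ c * ((C.card : ℝ) / A.card) :=
    ((le_abs_self _).trans (habs hC)).trans_eq (by ring)
  have hcompl : ∑ k ∈ C, x k ≤ c * (1 - (C.card : ℝ) / A.card) := by
    classical
    calc ∑ k ∈ C, x k = -∑ k ∈ A \ C, x k := by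
          rw [eq_neg_iff_add_eq_zero, add_comm, Finset.sum_sdiff hC, hsum]
      _ ≤ (A \ C).card * (c / A.card) := (neg_le_abs _).trans (habs Finset.sdiff_subset)
      _ = c * (1 - (C.card : ℝ) / A.card) := by
          rw [Finset.card_sdiff_of_subset hC, Nat.cast_sub (Finset.card_le_card hC)]
          have : (A.card : ℝ) ≠ 0 := Nat.cast_ne_zero.2 hA.card_ne_zero
          field_simp
  rcases min_choice ((C.card : ℝ) / A.card) (1 - (C.card : ℝ) / A.card) with h | h <;> rwa [h]

variable [DecidableEq ι] {F : Finset ι → ℝ} {B : Finset ι} {η : ℝ}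

/-- The inseparability margin of `A` for the contraction of `F` by `B`: the increments of `F` on
the parts of `A` exceed the linear interpolation between `∅` and `A` by at least `η` times the
relative distance to these two sets. -/
def HasMargin (F : Finset ι → ℝ) (B A : Finset ι) (η : ℝ) : Prop :=
  ∀ C ⊆ A, η * min ((C.card : ℝ) / A.card) (1 - (C.card : ℝ) / A.card) ≤
    F (B ∪ C) - F B - (C.card : ℝ) / A.card * (F (B ∪ A) - F B)

lemma HasMargin.smul (h : HasMargin F B A η) (hc : 0 ≤ c) : HasMargin (c • F) B A (c * η) := by
  intro C hC
  calc c * η * min ((C.card : ℝ) / A.card) (1 - (C.card : ℝ) / A.card)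
      ≤ c * (F (B ∪ C) - F B - (C.card : ℝ) / A.card * (F (B ∪ A) - F B)) := by
        rw [mul_assoc]
        exact mul_le_mul_of_nonneg_left (h C hC) hc
    _ = _ := by
        simp only [Pi.smul_apply, smul_eq_mul]
        ring

/-- The average of `x` over `A`, minus the increment of `F` per element of `A`. This is the value
on the block `A` of the candidate minimizer for the data `x`. -/
noncomputable def biasedMean (F : Finset ι → ℝ) (B A : Finset ι) (x : ι → ℝ) : ℝ :=
  𝔼 k ∈ A, x k - (F (B ∪ A) - F B) / A.card

lemma sum_sub_biasedMean_eq (hA : A.Nonempty) (F : Finset ι → ℝ) (B : Finset ι) (x : ι → ℝ) :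
    ∑ k ∈ A, (x k - biasedMean F B A x) = F (B ∪ A) - F B := by
  simp only [biasedMean, ← sub_add, Finset.sum_add_distrib, sum_sub_expect, zero_add,
    Finset.sum_const, nsmul_eq_mul]
  exact mul_div_cancel₀ _ (Nat.cast_ne_zero.2 hA.card_ne_zero)

lemma HasMargin.sum_sub_biasedMean_le (h : HasMargin F B A η) (hA : A.Nonempty)
    (hx : ∀ k ∈ A, |x k - 𝔼 l ∈ A, x l| ≤ η / A.card) (hC : C ⊆ A) :
    ∑ k ∈ C, (x k - biasedMean F B A x) ≤ F (B ∪ C) - F B := by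
  have hcentred := (sum_le_mul_min_of_abs_le hA (sum_sub_expect A x) hx hC).trans (h C hC)
  simp only [biasedMean, ← sub_add, Finset.sum_add_distrib, Finset.sum_const, nsmul_eq_mul]
  rw [← mul_comm_div]
  linarith

end Margin

section Recovery

variable {m : ℕ} {F : Finset (Fin p) → ℝ} {D : Set (Finset (Fin p))} {A : Fin m → Finset (Fin p)}
  {lam ν : ℝ} {η v vstar : Fin m → ℝ} {x z u w wstar : EuclideanSpace ℝ (Fin p)}

theorem isProxSolution_of_hasMargin (hF : IsNormalizedSubmodular F) (hlam : 0 ≤ lam)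
    (hD : IsSetLattice D) (hmod : ∀ S ∈ D, ∀ T ∈ D, F S + F T = F (S ∪ T) + F (S ∩ T))
    (hA : IsTopologicalOrdering D A)
    (hmargin : ∀ j : Fin m, HasMargin F (prefixUnion A j) (A j) (η j))
    (hz : ∀ j, ∀ k ∈ A j, |z k - 𝔼 l ∈ A j, z l| ≤ lam * η j / (A j).card)
    (hu : ∀ j : Fin m, ∀ k ∈ A j, u k = biasedMean (lam • F) (prefixUnion A j) (A j) z)
    (hface : InOpenFace D u) : IsProxSolution F lam z u := by
  have hG := hF.smul hlam
  have hne (j : Fin m) : (A j).Nonempty := (hA.isBlock j).nonempty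
  have hblock (j : Fin m) {C : Finset (Fin p)} (hC : C ⊆ A j) : ∑ k ∈ C, (z - u) k =
      ∑ k ∈ C, (z k - biasedMean (lam • F) (prefixUnion A j) (A j) z) :=
    Finset.sum_congr rfl fun k hk => congrArg (z k - ·) (hu j k (hC hk))
  have htight {S : Finset (Fin p)} (hS : S ∈ D) : ∑ k ∈ S, (z - u) k = (lam • F) S := by
    refine hA.sum_eq_of_modular hD hG.empty (fun S hS T hT => ?_) (fun j => ?_) hS
    · simpa only [Pi.smul_apply, smul_eq_mul, mul_add] using congrArg (lam * ·) (hmod S hS T hT)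
    · rw [hblock j subset_rfl, sum_sub_biasedMean_eq (hne j), prefixUnion_succ]
  have hdom : ∀ S, ∑ k ∈ S, (z - u) k ≤ (lam • F) S := by
    refine sum_le_of_forall_sum_le_sub (hA.existsUnique_mem hD) hG.empty hG.submodular
      fun j C hC => ?_
    rw [hblock j hC]
    exact ((hmargin j).smul hlam).sum_sub_biasedMean_le (hne j) (hz j) hC
  exact isProxSolution_of_sub_mem_basePolytope hF ⟨hdom, htight hD.univ_mem⟩
    fun α => htight (hface.levelSet_mem hD α)

lemma exists_forall_mem_eq (hA : ∀ k, ∃! j, k ∈ A j) (v : Fin m → ℝ) :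
    ∃ u : EuclideanSpace ℝ (Fin p), ∀ j, ∀ k ∈ A j, u k = v j := by
  choose b _ hunique using hA
  exact ⟨WithLp.toLp 2 (v ∘ b), fun j k hk => congrArg v (hunique k j hk).symm⟩

lemma IsTopologicalOrdering.inOpenFace_of_abs_sub_lt (hA : IsTopologicalOrdering D A)
    (hgap : ∀ i j, i ≠ j → BlockGE D (A i) (A j) → ν ≤ vstar i - vstar j)
    (hclose : ∀ j, |v j - vstar j| < ν / 2) (hu : ∀ j, ∀ k ∈ A j, u k = v j) :
    InOpenFace D u := by
  refine ⟨fun B hB k hk l hl => ?_, fun B B' hB hB' hne hge k hk l hl => ?_⟩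
  · obtain ⟨j, rfl⟩ := (hA.isBlock_iff B).1 hB
    rw [hu j k hk, hu j l hl]
  · obtain ⟨i, rfl⟩ := (hA.isBlock_iff B).1 hB
    obtain ⟨j, rfl⟩ := (hA.isBlock_iff B').1 hB'
    rw [hu i k hk, hu j l hl]
    linarith [hgap i j (ne_of_apply_ne A hne) hge, abs_lt.1 (hclose i), abs_lt.1 (hclose j)]

theorem inOpenFace_of_isProxSolution (hF : IsNormalizedSubmodular F) (hlam : 0 ≤ lam)
    (hD : IsSetLattice D) (hmod : ∀ S ∈ D, ∀ T ∈ D, F S + F T = F (S ∪ T) + F (S ∩ T))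
    (hA : IsTopologicalOrdering D A) (hv : ∀ j, ∀ k ∈ A j, wstar k = vstar j)
    (hmargin : ∀ j : Fin m, HasMargin F (prefixUnion A j) (A j) (η j))
    (hgap : ∀ i j, i ≠ j → BlockGE D (A i) (A j) → ν ≤ vstar i - vstar j)
    (hbias : ∀ j : Fin m,
      lam * |(F (prefixUnion A (j + 1)) - F (prefixUnion A j)) / (A j).card| ≤ ν / 4)
    (hmean : ∀ j, |𝔼 k ∈ A j, x k| < ν / 4)
    (hcentred : ∀ j, ∀ k ∈ A j, |x k - 𝔼 l ∈ A j, x l| ≤ lam * η j / (A j).card)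
    (hw : IsProxSolution F lam (wstar + x) w) : InOpenFace D w := by
  have haverage (j : Fin m) : 𝔼 k ∈ A j, (wstar + x) k = vstar j + 𝔼 k ∈ A j, x k := by
    simp only [PiLp.add_apply, Finset.expect_add_distrib, Finset.expect_congr rfl (hv j),
      Finset.expect_const (hA.isBlock j).nonempty]
  let v (j : Fin m) : ℝ := biasedMean (lam • F) (prefixUnion A j) (A j) (wstar + x :)
  have hclose (j : Fin m) : |v j - vstar j| < ν / 2 := by
    have hj := hbias j
    rw [← abs_of_nonneg hlam, ← abs_mul] at hj
    calc |v j - vstar j| = |𝔼 k ∈ A j, x k -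
          lam * ((F (prefixUnion A (j + 1)) - F (prefixUnion A j)) / (A j).card)| := by
          simp only [v, biasedMean, haverage, Pi.smul_apply, smul_eq_mul, ← prefixUnion_succ]
          ring_nf
      _ ≤ _ := abs_sub _ _
      _ < ν / 2 := by linarith [hmean j]
  obtain ⟨u, hu⟩ := exists_forall_mem_eq (hA.existsUnique_mem hD) v
  have hface := hA.inOpenFace_of_abs_sub_lt hgap hclose hu
  have hsol : IsProxSolution F lam (wstar + x) u := by
    refine isProxSolution_of_hasMargin hF hlam hD hmod hA hmargin (fun j k hk => ?_) hu hface
    rw [haverage, PiLp.add_apply, hv j k hk, add_sub_add_left_eq_sub]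
    exact hcentred j k hk
  rwa [(existsUnique_isProxSolution hF hlam _).unique hw hsol]

end Recovery

end LevelSet

open LevelSet in
open scoped BigOperators in
theorem theorem1_general {p m : ℕ} {Ω : Type*} [MeasurableSpace Ω] (P : Measure Ω)
    [IsProbabilityMeasure P]
    (F : Finset (Fin p) → ℝ) (hF : IsNormalizedSubmodular F)
    (lam sigma : ℝ) (hlam : 0 ≤ lam) (hsigma : 0 < sigma)
    (ε : Ω → EuclideanSpace ℝ (Fin p))
    (hε : HasLaw ε (stdGaussian (EuclideanSpace ℝ (Fin p))) P)
    (wstar : EuclideanSpace ℝ (Fin p))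
    (D : Set (Finset (Fin p))) (hD : IsSetLattice D)
    (hmod : ∀ S ∈ D, ∀ T ∈ D, F S + F T = F (S ∪ T) + F (S ∩ T))
    (A : Fin m → Finset (Fin p)) (hA : IsTopologicalOrdering D A)
    (vstar : Fin m → ℝ) (hv : ∀ j, ∀ k ∈ A j, wstar k = vstar j)
    (η : Fin m → ℝ) (hη : ∀ j, 0 ≤ η j) (ν : ℝ)
    (hmargin : ∀ j : Fin m, HasMargin F (prefixUnion A j) (A j) (η j))
    (hgap : ∀ i j, i ≠ j → BlockGE D (A i) (A j) → ν ≤ vstar i - vstar j)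
    (hbias : ∀ j : Fin m,
      lam * |(F (prefixUnion A (j + 1)) - F (prefixUnion A j)) / (A j).card| ≤ ν / 4) :
    (∀ z, ∃! w, IsProxSolution F lam z w) ∧
    ∀ what : Ω → EuclideanSpace ℝ (Fin p),
      (∀ ω, IsProxSolution F lam (wstar + sigma • ε ω) (what ω)) →
      1 - ∑ j, Real.exp (-(ν ^ 2 * (A j).card / (32 * sigma ^ 2)))
        - ∑ j, ((A j).card : ℝ) *
            Real.exp (-(lam ^ 2 * η j ^ 2 / (2 * sigma ^ 2 * ((A j).card : ℝ) ^ 2)))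
        ≤ P.real {ω | InOpenFace D (what ω)} := by
  refine ⟨existsUnique_isProxSolution hF hlam, fun what hwhat => ?_⟩
  have hν (j : Fin m) : 0 ≤ ν / 4 := (mul_nonneg hlam (abs_nonneg _)).trans (hbias j)
  have htails := one_sub_sum_exp_sub_sum_exp_le_measureReal hε (t := fun _ => ν / 4 / sigma)
    (r := fun j => lam * η j / (A j).card / sigma) (fun j => (hA.isBlock j).nonempty)
    (fun j => div_nonneg (hν j) hsigma.le) fun j => by have := hη j; positivity
  refine (le_of_eq ?_).trans (htails.trans (measureReal_mono fun ω hω => ?_))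
  · congr! 5 <;> ring
  · have hexpect (j : Fin m) : 𝔼 k ∈ A j, (sigma • ε ω) k = sigma * 𝔼 k ∈ A j, ε ω k :=
      (Finset.mul_expect _ _ _).symm
    refine inOpenFace_of_isProxSolution hF hlam hD hmod hA hv hmargin hgap hbias (fun j => ?_)
      (fun j k hk => ?_) (hwhat ω)
    · rw [hexpect, abs_mul, abs_of_pos hsigma]
      exact (lt_div_iff₀' hsigma).1 (hω.1 j)
    · rw [hexpect, PiLp.smul_apply, smul_eq_mul, ← mul_sub, abs_mul, abs_of_pos hsigma]
      exact (le_div_iff₀' hsigma).1 (hω.2 j k hk).le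

theorem theorem1 {p m : ℕ} {Ω : Type*} [MeasurableSpace Ω] (P : Measure Ω)
    [IsProbabilityMeasure P]
    (F : Finset (Fin p) → ℝ) (hF : LevelSet.IsPenalty F)
    (lam sigma : ℝ) (hlam : 0 ≤ lam) (hsigma : 0 < sigma)
    (ε : Ω → EuclideanSpace ℝ (Fin p))
    (hε : HasLaw ε (stdGaussian (EuclideanSpace ℝ (Fin p))) P)
    (wstar : EuclideanSpace ℝ (Fin p))
    (D : Set (Finset (Fin p))) (hD : LevelSet.IsAssociated F D wstar)
    (A : Fin m → Finset (Fin p)) (hA : LevelSet.IsTopologicalOrdering D A)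
    (vstar : Fin m → ℝ) (hv : ∀ j, ∀ k ∈ A j, wstar k = vstar j)
    (η : Fin m → ℝ) (hη : ∀ j, 0 < η j) (ν : ℝ) (hν : 0 < ν)
    (hmargin : ∀ j, ∀ C ⊆ A j,
      η j * min ((C.card : ℝ) / (A j).card) (1 - (C.card : ℝ) / (A j).card) ≤
        F (LevelSet.prefixUnion A j ∪ C) - F (LevelSet.prefixUnion A j)
          - (C.card : ℝ) / (A j).card *
            (F (LevelSet.prefixUnion A j ∪ A j) - F (LevelSet.prefixUnion A j)))
    (hgap : ∀ i j, i ≠ j → LevelSet.BlockGE D (A i) (A j) → ν ≤ vstar i - vstar j)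
    (hbias : ∀ j : Fin m,
      lam * |(F (LevelSet.prefixUnion A (j + 1)) - F (LevelSet.prefixUnion A j)) / (A j).card|
        ≤ ν / 4) :
    (∀ z, ∃! w, LevelSet.IsProxSolution F lam z w) ∧
    ∀ what : Ω → EuclideanSpace ℝ (Fin p),
      (∀ ω, LevelSet.IsProxSolution F lam (wstar + sigma • ε ω) (what ω)) →
      1 - ∑ j, Real.exp (-(ν ^ 2 * (A j).card / (32 * sigma ^ 2)))
        - 2 * ∑ j, ((A j).card : ℝ) *
            Real.exp (-(lam ^ 2 * η j ^ 2 / (2 * sigma ^ 2 * ((A j).card : ℝ) ^ 2)))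
        ≤ P.real {ω | LevelSet.IsAssociated F D (what ω)} := by
  have hpre := hD.1.toIsPreAllowed
  obtain ⟨hprox, hbound⟩ := theorem1_general P F hF.isNormalizedSubmodular lam sigma hlam hsigma ε
    hε wstar D hpre.lattice hpre.modular A hA vstar hv η (fun j => (hη j).le) ν hmargin hgap hbias
  refine ⟨hprox, fun what hwhat => le_trans
    (sub_le_sub_left (le_mul_of_one_le_left ?_ one_le_two) _)
    ((hbound what hwhat).trans (measureReal_mono fun ω hω => ⟨hD.1, hω⟩))⟩
  exact Finset.sum_nonneg fun j _ => by positivity
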